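/- **Setting.** For $r\ge 1$ let $\phi_r(x)=e^{x^r}-1$ ($x\ge 0$). For a probability measure $\mu$, let $L^{\phi_r}(\mu)$ be the set of ($\mu$-a.e. equivalence classes of) measurable real functions $f$ with $\inf\{c>0:\int \phi_r(|f|/c)\,d\mu\le 1\}<\infty$, and let $E^{\phi_r}(\mu)$ be the set of $f\in L^{\phi_r}(\mu)$ with $\int\phi_r(|f|/c)\,d\mu<\infty$ for every $c>0$. Let $\mathcal X$ be a measurable space, $Q$ a Markov transition kernel on $\mathcal X$ and $Q_0$ a stationary probability distribution of $Q$. Write $E^{\phi_r}=E^{\phi_r}(Q_0)$ and $E^{\phi_r}_2=E^{\phi_r}(Q_0\otimes Q)$, where $(Q_0\otimes Q)(dx,dy)=Q_0(dx)\,Q(dy\mid x)$ is the stationary law of $(X_t,X_{t+1})$. Let $\beta\in(0,1)$, $\theta>0$ and $\alpha=-\frac{1}{\theta(1-\beta)}$. For $u:\mathcal X^2\to\mathbb R$ define $$\mathbb T f(x)=\beta\log \mathbb E^{Q}\big[e^{f(X_{t+1})+\alpha u(X_t,X_{t+1})}\,\big|\,X_t=x\big]=\beta\log\int e^{f(y)+\alpha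 u(x,y)}\,Q(dy\mid x).$$ **Theorem 3.1.** Let $u\in E^{\phi_r}_2$ for some $r>1$. For each $1\le s\le r$, $\mathbb T$ is a well-defined map from $E^{\phi_s}$ to $E^{\phi_s}$ (in particular, for each $f\in E^{\phi_s}$ the expectation defining $\mathbb Tf(x)$ is finite for $Q_0$-almost every $x$). Moreover, $\mathbb T$ has a fixed point $v\in E^{\phi_r}$, and this $v$ is the unique fixed point of $\mathbb T$ in $E^{\phi_s}$ for each $1<s\le r$. -/

import Mathlib

open MeasureTheory ProbabilityTheory
open scoped ENNReal

namespace RobustControl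

noncomputable section

/-- The Young function `φ_r(x) = exp(x ^ r) - 1`, used for `x ≥ 0` and `r ≥ 1`. -/
def orliczPhi (r x : ℝ) : ℝ := Real.exp (x ^ r) - 1

/-- The modular `E^μ[φ_r(|f| / c)]`, an element of `[0, ∞]`. -/
def orliczModular {Ω : Type*} [MeasurableSpace Ω] {μ : Measure Ω} (r : ℝ) (f : Ω →ₘ[μ] ℝ)
    (c : ℝ) : ℝ≥0∞ :=
  ∫⁻ ω, ENNReal.ofReal (orliczPhi r (|f ω| / c)) ∂μ

/-- The Luxemburg norm `inf {c > 0 : E^μ[φ_r(|f| / c)] ≤ 1}`, with `inf ∅ = ∞`. -/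
def orliczNorm {Ω : Type*} [MeasurableSpace Ω] {μ : Measure Ω} (r : ℝ) (f : Ω →ₘ[μ] ℝ) : ℝ≥0∞ :=
  ⨅ (c : ℝ) (_ : 0 < c) (_ : orliczModular r f c ≤ 1), ENNReal.ofReal c

/-- The Orlicz space `L^{φ_r}(μ)`: classes, modulo `μ`-a.e. equality, of measurable real functions
with finite Luxemburg norm. -/
def orliczSpace {Ω : Type*} [MeasurableSpace Ω] (μ : Measure Ω) (r : ℝ) : Set (Ω →ₘ[μ] ℝ) :=
  {f | orliczNorm r f < ∞}

/-- The Orlicz heart `E^{φ_r}(μ)`: the `f ∈ L^{φ_r}(μ)` with `E^μ[φ_r(|f| / c)] < ∞` for every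
`c > 0`. -/
def orliczHeart {Ω : Type*} [MeasurableSpace Ω] (μ : Measure Ω) (r : ℝ) : Set (Ω →ₘ[μ] ℝ) :=
  {f | f ∈ orliczSpace μ r ∧ ∀ c : ℝ, 0 < c → orliczModular r f c < ∞}

/-- For `r ≥ 1`, finiteness of all modulars already implies finiteness of the Luxemburg norm. -/
theorem mem_orliczHeart_iff {Ω : Type*} [MeasurableSpace Ω] {μ : Measure Ω} {r : ℝ} (hr : 1 ≤ r)
    (f : Ω →ₘ[μ] ℝ) :
    f ∈ orliczHeart μ r ↔ ∀ c : ℝ, 0 < c → orliczModular r f c < ∞ := by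
  refine ⟨fun h => h.2, fun h => ⟨?_, h⟩⟩
  set K := (orliczModular r f 1).toReal with hK
  have hK0 : 0 ≤ K := ENNReal.toReal_nonneg
  have h1 : orliczModular r f 1 = ENNReal.ofReal K := (ENNReal.ofReal_toReal (h 1 one_pos).ne).symm
  have hc : 0 < 1 + K := by linarith
  have ht0 : 0 < 1 / (1 + K) := by positivity
  have ht1 : 1 / (1 + K) ≤ 1 := by
    rw [div_le_one hc]; linarith
  have key : ∀ x : ℝ, 0 ≤ x → orliczPhi r (x / (1 + K)) ≤ 1 / (1 + K) * orliczPhi r x := by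
    intro x hx
    have hz : 0 ≤ x ^ r := Real.rpow_nonneg hx r
    have e1 : (x / (1 + K)) ^ r ≤ 1 / (1 + K) * x ^ r := by
      rw [div_eq_mul_one_div, mul_comm x, Real.mul_rpow ht0.le hx]
      exact mul_le_mul_of_nonneg_right (Real.rpow_le_self_of_le_one ht0.le ht1 hr) hz
    have e2 := convexOn_exp.2 (Set.mem_univ (x ^ r)) (Set.mem_univ 0) ht0.le
      (sub_nonneg.2 ht1) (by ring)
    simp only [smul_eq_mul, mul_zero, add_zero, Real.exp_zero, mul_one] at e2
    have e3 := Real.exp_le_exp.2 e1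
    unfold orliczPhi
    linarith
  have hle : orliczModular r f (1 + K) ≤ 1 := by
    calc orliczModular r f (1 + K)
        ≤ ∫⁻ ω, ENNReal.ofReal (1 / (1 + K)) * ENNReal.ofReal (orliczPhi r (|f ω| / 1)) ∂μ := by
          refine lintegral_mono fun ω => ?_
          rw [← ENNReal.ofReal_mul ht0.le, div_one]
          exact ENNReal.ofReal_le_ofReal (key _ (abs_nonneg _))
      _ = ENNReal.ofReal (1 / (1 + K)) * orliczModular r f 1 :=
          lintegral_const_mul' _ _ ENNReal.ofReal_ne_top
      _ ≤ 1 := by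
          rw [h1, ← ENNReal.ofReal_mul ht0.le, ENNReal.ofReal_le_one, one_div_mul_eq_div,
            div_le_one hc]
          linarith
  exact lt_of_le_of_lt (iInf₂_le_of_le (1 + K) hc (iInf_le _ hle)) ENNReal.ofReal_lt_top

/-- The composite parameter `α = -1 / (θ (1 - β))`. -/
def compositeParam (β θ : ℝ) : ℝ := -(1 / (θ * (1 - β)))

/-- The function `x ↦ β log E^Q[exp(f(X_{t+1}) + α u(X_t, X_{t+1})) | X_t = x]`, the conditional
expectation being the integral against the transition kernel `Q`. -/
def continuationFun {X : Type*} [MeasurableSpace X] (Q : Kernel X X) (β α : ℝ) (u : X × X → ℝ)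
    (f : X → ℝ) (x : X) : ℝ :=
  β * Real.log (∫ y, Real.exp (f y + α * u (x, y)) ∂(Q x))

theorem measurable_continuationFun {X : Type*} [MeasurableSpace X] (Q : Kernel X X)
    [IsMarkovKernel Q] (β α : ℝ) {u : X × X → ℝ} (hu : Measurable u) {f : X → ℝ}
    (hf : Measurable f) : Measurable (continuationFun Q β α u f) := by
  have h : StronglyMeasurable fun p : X × X => Real.exp (f p.2 + α * u (p.1, p.2)) := by
    apply Measurable.stronglyMeasurable
    fun_prop
  exact (Real.measurable_log.comp h.integral_kernel_prod_right'.measurable).const_mul β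

/-- Changing `f` on a `Q₀`-null set and `u` on a `Q₀ ⊗ Q`-null set changes `continuationFun` on a
`Q₀`-null set only, because `Q₀` is stationary for `Q`. -/
theorem continuationFun_congr {X : Type*} [MeasurableSpace X] (Q : Kernel X X) [IsMarkovKernel Q]
    (Q₀ : Measure X) [IsProbabilityMeasure Q₀] (hQ : Kernel.Invariant Q Q₀) (β α : ℝ)
    {u u' : X × X → ℝ} (hu : u =ᵐ[Q₀ ⊗ₘ Q] u') {f f' : X → ℝ} (hf : f =ᵐ[Q₀] f') :
    continuationFun Q β α u f =ᵐ[Q₀] continuationFun Q β α u' f' := by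
  have hf' : ∀ᵐ y ∂(Q₀.bind Q), f y = f' y := by rw [hQ.def]; exact hf
  filter_upwards [Measure.ae_ae_of_ae_comp hf', Measure.ae_ae_of_ae_compProd hu] with x h1 h2
  unfold continuationFun
  congr 2
  refine integral_congr_ae ?_
  filter_upwards [h1, h2] with y h3 h4
  rw [h3, h4]

/-- The operator `T` on classes of functions:
`T f (x) = β log E^Q[exp(f(X_{t+1}) + α u(X_t, X_{t+1})) | X_t = x]`. For stationary `Q₀` it does
not depend on the representatives of `f` and `u`, by `continuationFun_congr`. -/
def continuationOp {X : Type*} [MeasurableSpace X] (Q : Kernel X X) [IsMarkovKernel Q]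
    (Q₀ : Measure X) [IsProbabilityMeasure Q₀] (β α : ℝ) (u : X × X →ₘ[Q₀ ⊗ₘ Q] ℝ)
    (f : X →ₘ[Q₀] ℝ) : X →ₘ[Q₀] ℝ :=
  AEEqFun.mk (continuationFun Q β α u f)
    (measurable_continuationFun Q β α u.measurable f.measurable).aestronglyMeasurable

end

end RobustControl

/-! Put `h = exp(f / β)` and `k = exp(α u)`. Then `T f = f` becomes `S h = h`, where `S h (x)` is
the conditional expectation of `k h ^ β` (`weightedOp`). This `S` is monotone and commutes with
increasing suprema. Young's inequality and stationarity give `E[S h] ≤ (1 - β) E[k ^ (1 / (1 - β))]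
+ β E[h]`; since `β < 1`, expectations stay bounded along orbits.

Invariance of the Orlicz hearts rests on `exp_rpow_log_lintegral_le`: the modular of `log E[exp Y]`
is controlled by `E[exp Y]` and the modular of `Y`.

Existence: for the weight `exp |α u|`, the orbit of `1` increases to a fixed point `H ≥ 1`. A
recursion with factor `β`, followed by Fatou, puts `log H` in the heart. By the harmonic mean
inequality `H⁻¹` is a subsolution for `exp(α u)`, and its orbit stays below `H`. The limit `V` is a
fixed point with `H⁻¹ ≤ V ≤ H`, so `v = β log V` satisfies `|v| ≤ β log H`.

Uniqueness: `log S` is convex in `log h`. If `V` and `W` are fixed points, extrapolating beyond `W`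
to `B = W ^ p V ^ (1 - p)` gives `B ≤ S B`, hence `E[B] ≤ E[k ^ (1 / (1 - β))]` for all `p ≥ 1` with
`E[B]` finite. Letting `p → ∞` forces `W ≤ V`; by symmetry `W = V`. -/

namespace RobustControl

/-! ### Inequalities for means, powers and exponentials. -/

/-- Jensen's inequality for powers and lower Lebesgue integrals. -/
theorem lintegral_rpow_le_lintegral_rpow {Ω : Type*} [MeasurableSpace Ω] (P : Measure Ω)
    [IsProbabilityMeasure P] {F : Ω → ℝ≥0∞} (hF : Measurable F) {p : ℝ} (hp : 1 ≤ p) :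
    (∫⁻ ω, F ω ∂P) ^ p ≤ ∫⁻ ω, F ω ^ p ∂P := by
  have hp0 : 0 < p := by linarith
  -- Hölder's inequality for `F ^ p` and the constant `1`.
  have h := ENNReal.lintegral_mul_norm_pow_le (μ := P) (hF.pow_const p).aemeasurable
    (aemeasurable_const (b := (1 : ℝ≥0∞))) (p := 1 / p) (q := 1 - 1 / p) (by positivity)
    (by rw [sub_nonneg, div_le_one hp0]; exact hp) (by ring)
  simp only [ENNReal.one_rpow, mul_one, lintegral_const, measure_univ] at h
  have e : ∀ ω, (F ω ^ p) ^ (1 / p) = F ω := fun ω => by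
    rw [← ENNReal.rpow_mul, mul_one_div_cancel hp0.ne', ENNReal.rpow_one]
  simp only [e] at h
  calc (∫⁻ ω, F ω ∂P) ^ p ≤ ((∫⁻ ω, F ω ^ p ∂P) ^ (1 / p)) ^ p := by gcongr
    _ = _ := by rw [← ENNReal.rpow_mul, one_div_mul_cancel hp0.ne', ENNReal.rpow_one]

/-- The harmonic mean is at most the arithmetic mean. -/
theorem inv_lintegral_le_lintegral_inv {Ω : Type*} [MeasurableSpace Ω] (P : Measure Ω)
    [IsProbabilityMeasure P] {F : Ω → ℝ≥0∞} (hF : Measurable F) :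
    (∫⁻ ω, F ω ∂P)⁻¹ ≤ ∫⁻ ω, (F ω)⁻¹ ∂P := by
  by_cases h1 : ∫⁻ ω, F ω ∂P = ∞
  · simp [h1]
  by_cases h2 : ∫⁻ ω, (F ω)⁻¹ ∂P = ∞
  · simp [h2]
  -- Cauchy–Schwarz for `F` and `F⁻¹`, whose product is `1` almost everywhere because both integrals
  -- are finite.
  have h := ENNReal.lintegral_mul_norm_pow_le (μ := P) hF.aemeasurable
    hF.inv.aemeasurable (p := 1 / 2) (q := 1 / 2) (by norm_num) (by norm_num) (by norm_num)
  have e : ∫⁻ ω, F ω ^ (1 / 2 : ℝ) * (F⁻¹) ω ^ (1 / 2 : ℝ) ∂P = 1 := by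
    have : ∀ᵐ ω ∂P, F ω ^ (1 / 2 : ℝ) * (F⁻¹) ω ^ (1 / 2 : ℝ) = 1 := by
      filter_upwards [ae_lt_top hF h1, ae_lt_top hF.inv h2] with ω h3 h4
      rw [← ENNReal.mul_rpow_of_nonneg _ _ (by norm_num), Pi.inv_apply,
        ENNReal.mul_inv_cancel (by simpa using h4.ne) h3.ne, ENNReal.one_rpow]
    rw [lintegral_congr_ae this]; simp
  rw [e, ← ENNReal.mul_rpow_of_nonneg _ _ (by norm_num)] at h
  have h' : 1 ≤ (∫⁻ ω, F ω ∂P) * ∫⁻ ω, (F ω)⁻¹ ∂P := by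
    by_contra hc
    exact absurd h (not_le.2 (ENNReal.rpow_lt_one (not_le.1 hc) (by norm_num)))
  exact ENNReal.inv_le_iff_le_mul (fun h => absurd h h2) (fun h => absurd h h1) |>.2 h'

/-- The tangent line inequality for `x ↦ x ^ r` on the nonnegative reals, at a point `t > 0`. -/
theorem rpow_tangent_le {r : ℝ} (hr : 1 ≤ r) {t x : ℝ} (ht : 0 < t) (hx : 0 ≤ x) :
    t ^ r + r * t ^ r / t * (x - t) ≤ x ^ r := by
  -- Bernoulli's inequality for `x / t`, rescaled by `t ^ r`.
  have h := one_add_mul_self_le_rpow_one_add (s := x / t - 1) (p := r)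
    (by linarith [div_nonneg hx ht.le]) hr
  rw [add_sub_cancel, Real.div_rpow hx ht.le] at h
  have ht' : 0 < t ^ r := Real.rpow_pos_of_pos ht r
  rw [le_div_iff₀ ht'] at h
  calc _ = (1 + r * (x / t - 1)) * t ^ r := by field_simp
    _ ≤ _ := h

/-- For `Y ≥ 0`, the function `exp ((· / c) ^ r)` of the entropic mean `log E[exp Y]` is controlled
by the expectations of `exp Y` and `exp ((Y / c) ^ r)`. -/
theorem exp_rpow_log_lintegral_le {Ω : Type*} [MeasurableSpace Ω] (P : Measure Ω)
    [IsProbabilityMeasure P] {Y : Ω → ℝ} (hY : Measurable Y) (hY0 : ∀ ω, 0 ≤ Y ω) {r c : ℝ}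
    (hr : 1 ≤ r) (hc : 0 < c) :
    ENNReal.ofReal (Real.exp ((Real.log (∫⁻ ω, ENNReal.ofReal (Real.exp (Y ω)) ∂P).toReal / c) ^ r))
      ≤ ∫⁻ ω, ENNReal.ofReal (Real.exp (Y ω)) ∂P
        + ∫⁻ ω, ENNReal.ofReal (Real.exp ((Y ω / c) ^ r)) ∂P := by
  set z := ∫⁻ ω, ENNReal.ofReal (Real.exp (Y ω)) ∂P with hz
  by_cases hzt : z = ∞
  · simp [hzt]
  have hz1 : 1 ≤ z := by
    calc (1 : ℝ≥0∞) = ∫⁻ _, 1 ∂P := by simp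
      _ ≤ z := lintegral_mono fun ω => by simpa using hY0 ω
  have hzr : 1 ≤ z.toReal := by
    simpa using ENNReal.toReal_mono hzt hz1
  set t := Real.log z.toReal with ht
  have ht0 : 0 ≤ t := Real.log_nonneg hzr
  have hzt' : z = ENNReal.ofReal (Real.exp t) := by
    rw [ht, Real.exp_log (by linarith), ENNReal.ofReal_toReal hzt]
  rcases ht0.eq_or_lt with h0 | h0
  · refine le_trans ?_ le_self_add
    rw [← h0, zero_div, Real.zero_rpow (by linarith)]
    simpa using hz1
  have htc : 0 < t / c := div_pos h0 hc
  set q := (t / c) ^ r with hq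
  have hq0 : 0 < q := Real.rpow_pos_of_pos htc r
  -- `r * q / t` is the slope `l` of `y ↦ (y / c) ^ r` at `t`. If `l ≤ 1`, then `q ≤ t` and `exp q ≤
  -- z`. If `l > 1`, the tangent line at `t` bounds `(Y / c) ^ r` below by `q + l (Y - t)`, and
  -- Jensen with exponent `l` gives `E[exp(l Y)] ≥ exp(l t)`.
  by_cases hl : r * q / t ≤ 1
  · refine le_trans ?_ le_self_add
    rw [hzt']
    gcongr
    rw [div_le_one h0] at hl
    nlinarith
  · refine le_trans ?_ le_add_self
    set l := r * q / t with hldef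
    have h := lintegral_rpow_le_lintegral_rpow P
      (F := fun ω => ENNReal.ofReal (Real.exp (Y ω))) (by fun_prop) (not_le.1 hl).le
    have e : ∀ y : ℝ, ENNReal.ofReal (Real.exp y) ^ l = ENNReal.ofReal (Real.exp (l * y)) := by
      intro y
      rw [ENNReal.ofReal_rpow_of_pos (Real.exp_pos _), ← Real.exp_mul, mul_comm]
    simp only [e] at h
    rw [← hz, hzt', e] at h
    calc ENNReal.ofReal (Real.exp q)
        = ENNReal.ofReal (Real.exp (q - l * t)) * ENNReal.ofReal (Real.exp (l * t)) := by
          rw [← ENNReal.ofReal_mul (Real.exp_pos _).le, ← Real.exp_add]; ring_nf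
      _ ≤ ENNReal.ofReal (Real.exp (q - l * t))
            * ∫⁻ ω, ENNReal.ofReal (Real.exp (l * Y ω)) ∂P := by gcongr
      _ = ∫⁻ ω, ENNReal.ofReal (Real.exp (q - l * t)) * ENNReal.ofReal (Real.exp (l * Y ω)) ∂P :=
          (lintegral_const_mul' _ _ ENNReal.ofReal_ne_top).symm
      _ ≤ _ := by
          refine lintegral_mono fun ω => ?_
          rw [← ENNReal.ofReal_mul (Real.exp_pos _).le, ← Real.exp_add]
          gcongr
          have h3 := rpow_tangent_le hr htc (div_nonneg (hY0 ω) hc.le)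
          have h4 : r * (t / c) ^ r / (t / c) * (Y ω / c - t / c) = l * (Y ω - t) := by
            rw [hldef, hq]; field_simp
          rw [h4, ← hq] at h3
          linarith

/-- Convexity of `exp ((· / c) ^ r)` on the nonnegative reals, in the form used for splitting a
sum with weights `1 - β` and `β`. -/
theorem exp_rpow_add_le {r c β a b : ℝ} (hr : 1 ≤ r) (hc : 0 < c) (hβ0 : 0 < β) (hβ1 : β < 1)
    (ha : 0 ≤ a) (hb : 0 ≤ b) :
    Real.exp (((a + b) / c) ^ r) ≤
      (1 - β) * Real.exp ((a / ((1 - β) * c)) ^ r) + β * Real.exp ((b / (β * c)) ^ r) := by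
  have hβ : 0 < 1 - β := by linarith
  have h1 := (convexOn_rpow hr).2 (x := a / ((1 - β) * c)) (y := b / (β * c))
    (Set.mem_Ici.2 (by positivity)) (Set.mem_Ici.2 (by positivity)) hβ.le hβ0.le (by ring)
  simp only [smul_eq_mul] at h1
  have e : (1 - β) * (a / ((1 - β) * c)) + β * (b / (β * c)) = (a + b) / c := by field_simp
  rw [e] at h1
  have h2 := convexOn_exp.2 (Set.mem_univ ((a / ((1 - β) * c)) ^ r))
    (Set.mem_univ ((b / (β * c)) ^ r)) hβ.le hβ0.le (by ring)
  simp only [smul_eq_mul] at h2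
  exact (Real.exp_le_exp.2 h1).trans h2

/-- The weighted Young inequality for the weights `1 - β` and `β`. -/
theorem mul_rpow_le_weighted {β : ℝ} (hβ0 : 0 < β) (hβ1 : β < 1) (a b : ℝ≥0∞) :
    a * b ^ β ≤ ENNReal.ofReal (1 - β) * a ^ (1 / (1 - β)) + ENNReal.ofReal β * b := by
  have hβ : 0 < 1 - β := by linarith
  have hpq : (1 / (1 - β)).HolderConjugate (1 / β) := by
    rw [Real.holderConjugate_iff]
    constructor
    · rw [lt_div_iff₀ hβ]; linarith
    · simp
  have h := ENNReal.young_inequality a (b ^ β) hpq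
  rw [← ENNReal.rpow_mul, mul_one_div_cancel hβ0.ne', ENNReal.rpow_one, ENNReal.div_eq_inv_mul,
    ENNReal.div_eq_inv_mul, ← ENNReal.ofReal_inv_of_pos (by positivity),
    ← ENNReal.ofReal_inv_of_pos (by positivity)] at h
  simpa only [one_div, inv_inv] using h

/-! ### The operator in exponential form. -/

/-- The operator `h ↦ E^Q[k(X_t, X_{t+1}) h(X_{t+1}) ^ β | X_t = x]` on `[0, ∞]`-valued functions.
With `k = exp(α u)` and `h = exp(f / β)`, this is the exponential form of `T`. -/
noncomputable def weightedOp {X : Type*} [MeasurableSpace X] (Q : Kernel X X) (β : ℝ)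
    (k : X × X → ℝ≥0∞) (h : X → ℝ≥0∞) (x : X) : ℝ≥0∞ :=
  ∫⁻ y, k (x, y) * h y ^ β ∂(Q x)

section

variable {X : Type*} [MeasurableSpace X] {Q : Kernel X X} {β : ℝ}
  {k k' : X × X → ℝ≥0∞} {h h' : X → ℝ≥0∞}

theorem measurable_weightedOp [IsMarkovKernel Q] (hk : Measurable k) (hh : Measurable h) :
    Measurable (weightedOp Q β k h) := by
  have : Measurable fun p : X × X => k (p.1, p.2) * h p.2 ^ β := by fun_prop
  exact this.lintegral_kernel_prod_right'

theorem weightedOp_mono (hβ : 0 ≤ β) (hk : k ≤ k') (hh : h ≤ h') :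
    weightedOp Q β k h ≤ weightedOp Q β k' h' := fun _ =>
  lintegral_mono fun y => mul_le_mul' (hk _) (ENNReal.rpow_le_rpow (hh y) hβ)

/-- By stationarity, a `Q₀`-null set is null for `Q x` for `Q₀`-almost every `x`. -/
theorem weightedOp_mono_ae {Q₀ : Measure X} (hQ : Kernel.Invariant Q Q₀) (hβ : 0 ≤ β)
    (hh : h ≤ᵐ[Q₀] h') : weightedOp Q β k h ≤ᵐ[Q₀] weightedOp Q β k h' := by
  have hh' : ∀ᵐ y ∂(Q₀.bind Q), h y ≤ h' y := by rw [hQ.def]; exact hh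
  filter_upwards [Measure.ae_ae_of_ae_comp hh'] with x hx
  refine lintegral_mono_ae ?_
  filter_upwards [hx] with y hy
  gcongr

theorem weightedOp_congr_ae {Q₀ : Measure X} (hQ : Kernel.Invariant Q Q₀) (hβ : 0 ≤ β)
    (hh : h =ᵐ[Q₀] h') : weightedOp Q β k h =ᵐ[Q₀] weightedOp Q β k h' :=
  (weightedOp_mono_ae hQ hβ hh.le).antisymm (weightedOp_mono_ae hQ hβ hh.symm.le)

theorem weightedOp_iSup (hβ : 0 < β) (hk : Measurable k) {h : ℕ → X → ℝ≥0∞}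
    (hh : ∀ n, Measurable (h n)) (hmono : Monotone h) :
    weightedOp Q β k (⨆ n, h n) = ⨆ n, weightedOp Q β k (h n) := by
  funext x
  simp only [weightedOp, iSup_apply]
  rw [← lintegral_iSup]
  · refine lintegral_congr fun y => ?_
    rw [← ENNReal.mul_iSup]
    congr 1
    exact Monotone.map_iSup_of_continuousAt ENNReal.continuous_rpow_const.continuousAt
      (ENNReal.monotone_rpow_of_nonneg hβ.le) (ENNReal.zero_rpow_of_pos hβ)
  · intro n
    exact (hk.comp measurable_prodMk_left).mul ((hh n).pow_const β)
  · intro m n hmn y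
    exact mul_le_mul' le_rfl (ENNReal.rpow_le_rpow (hmono hmn y) hβ.le)

/-- Hölder's inequality for `weightedOp`. -/
theorem weightedOp_mul_rpow_le (hβ : 0 ≤ β) (hk : Measurable k) (hh : Measurable h)
    (hh' : Measurable h') {a b : ℝ} (ha : 0 ≤ a) (hb : 0 ≤ b) (hab : a + b = 1) (x : X) :
    weightedOp Q β k (fun y => h y ^ a * h' y ^ b) x ≤
      weightedOp Q β k h x ^ a * weightedOp Q β k h' x ^ b := by
  have hkx : Measurable fun y => k (x, y) := hk.comp measurable_prodMk_left
  refine le_trans (le_of_eq (lintegral_congr fun y => ?_)) (ENNReal.lintegral_mul_norm_pow_le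
    (hkx.mul (hh.pow_const β)).aemeasurable (hkx.mul (hh'.pow_const β)).aemeasurable ha hb hab)
  simp only [Pi.mul_apply]
  rw [ENNReal.mul_rpow_of_nonneg _ _ ha, ENNReal.mul_rpow_of_nonneg _ _ hb,
    ENNReal.mul_rpow_of_nonneg _ _ hβ, mul_mul_mul_comm, ← ENNReal.rpow_add_of_nonneg _ _ ha hb,
    hab, ENNReal.rpow_one, ← ENNReal.rpow_mul, ← ENNReal.rpow_mul, ← ENNReal.rpow_mul,
    ← ENNReal.rpow_mul, mul_comm a, mul_comm b]

/-- The orbit of a subsolution is increasing, and its limit is a fixed point of `weightedOp`. -/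
theorem weightedOp_iSup_iterate [IsMarkovKernel Q] (hβ : 0 < β) (hk : Measurable k) (hh : Measurable h)
    (hsub : h ≤ weightedOp Q β k h) :
    (∀ n, Measurable ((weightedOp Q β k)^[n] h)) ∧
    Monotone (fun n => (weightedOp Q β k)^[n] h) ∧
    weightedOp Q β k (⨆ n, (weightedOp Q β k)^[n] h) = ⨆ n, (weightedOp Q β k)^[n] h := by
  have hm : ∀ n, Measurable ((weightedOp Q β k)^[n] h) := by
    intro n
    induction n with
    | zero => exact hh
    | succ n ih => rw [Function.iterate_succ_apply']; exact measurable_weightedOp hk ih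
  have hS : Monotone (weightedOp Q β k) := fun _ _ h12 => weightedOp_mono hβ.le le_rfl h12
  have hmono : Monotone (fun n => (weightedOp Q β k)^[n] h) :=
    hS.monotone_iterate_of_le_map hsub
  refine ⟨hm, hmono, ?_⟩
  rw [weightedOp_iSup hβ hk hm hmono]
  have := hmono.iSup_nat_add 1
  simpa only [Function.iterate_succ_apply'] using this

theorem lintegral_compProd_snd [IsMarkovKernel Q]
    {Q₀ : Measure X} [SFinite Q₀] (hQ : Kernel.Invariant Q Q₀)
    (hh : Measurable h) : ∫⁻ p, h p.2 ∂(Q₀ ⊗ₘ Q) = ∫⁻ y, h y ∂Q₀ := by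
  rw [Measure.lintegral_compProd (f := fun p => h p.2) (hh.comp measurable_snd)]
  conv_rhs => rw [← hQ.def, Measure.lintegral_bind Q.aemeasurable hh.aemeasurable]

theorem lintegral_weightedOp [IsMarkovKernel Q]
    {Q₀ : Measure X} [SFinite Q₀] (hk : Measurable k)
    (hh : Measurable h) :
    ∫⁻ x, weightedOp Q β k h x ∂Q₀ = ∫⁻ p, k p * h p.2 ^ β ∂(Q₀ ⊗ₘ Q) := by
  rw [Measure.lintegral_compProd (by fun_prop)]
  rfl

/-- Young's inequality is applied pointwise; stationarity then replaces the mean of `h(X_{t+1})` by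
that of `h(X_t)`. -/
theorem lintegral_weightedOp_le [IsMarkovKernel Q]
    {Q₀ : Measure X} [SFinite Q₀] (hQ : Kernel.Invariant Q Q₀)
    (hβ0 : 0 < β) (hβ1 : β < 1) (hk : Measurable k) (hh : Measurable h) :
    ∫⁻ x, weightedOp Q β k h x ∂Q₀ ≤
      ENNReal.ofReal (1 - β) * ∫⁻ p, k p ^ (1 / (1 - β)) ∂(Q₀ ⊗ₘ Q)
        + ENNReal.ofReal β * ∫⁻ x, h x ∂Q₀ := by
  rw [lintegral_weightedOp hk hh, ← lintegral_compProd_snd hQ hh,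
    ← lintegral_const_mul' _ _ ENNReal.ofReal_ne_top,
    ← lintegral_const_mul' _ _ ENNReal.ofReal_ne_top, ← lintegral_add_left (by fun_prop)]
  exact lintegral_mono fun p => mul_rpow_le_weighted hβ0 hβ1 _ _

/-- `x ≤ (1 - β) a + β x` gives `x ≤ a` for finite `x`. -/
theorem le_of_le_weighted_self {a x : ℝ≥0∞} (hβ0 : 0 < β) (hβ1 : β < 1) (hx : x ≠ ∞)
    (hxa : x ≤ ENNReal.ofReal (1 - β) * a + ENNReal.ofReal β * x) : x ≤ a := by
  by_cases ha : a = ∞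
  · simp [ha]
  have h1 := ENNReal.toReal_mono (by finiteness) hxa
  rw [ENNReal.toReal_add (by finiteness) (by finiteness), ENNReal.toReal_mul, ENNReal.toReal_mul,
    ENNReal.toReal_ofReal (by linarith), ENNReal.toReal_ofReal hβ0.le] at h1
  rw [← ENNReal.toReal_le_toReal hx ha]
  nlinarith

/-- The induction step for bounds that are uniform along an orbit. -/
theorem weighted_le {a b x : ℝ≥0∞} (hβ0 : 0 < β) (hβ1 : β < 1) (ha : a ≤ x) (hb : b ≤ x) :
    ENNReal.ofReal (1 - β) * a + ENNReal.ofReal β * b ≤ x := by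
  calc _ ≤ ENNReal.ofReal (1 - β) * x + ENNReal.ofReal β * x := by gcongr
    _ = x := by rw [← add_mul, ← ENNReal.ofReal_add (by linarith) hβ0.le]; simp

/-- If `V` and `W` are fixed points of `weightedOp`, then `B = W ^ p V ^ (1 - p)` satisfies
`B ≤ weightedOp B`, and its expectation is bounded independently of `p`. -/
theorem lintegral_extrapolation_le [IsMarkovKernel Q]
    {Q₀ : Measure X} [SFinite Q₀] (hQ : Kernel.Invariant Q Q₀)
    (hβ0 : 0 < β) (hβ1 : β < 1) (hk : Measurable k) {V W : X → ℝ≥0∞} (hV : Measurable V)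
    (hW : Measurable W) (hV0 : ∀ x, V x ≠ 0) (hVt : ∀ x, V x ≠ ∞)
    (hVfix : weightedOp Q β k V =ᵐ[Q₀] V) (hWfix : weightedOp Q β k W =ᵐ[Q₀] W)
    {p : ℝ} (hp : 1 ≤ p) (hfin : ∫⁻ x, W x ^ p * V x ^ (1 - p) ∂Q₀ ≠ ∞) :
    ∫⁻ x, W x ^ p * V x ^ (1 - p) ∂Q₀ ≤ ∫⁻ p, k p ^ (1 / (1 - β)) ∂(Q₀ ⊗ₘ Q) := by
  have hp0 : 0 < p := by linarith
  set B : X → ℝ≥0∞ := fun x => W x ^ p * V x ^ (1 - p) with hB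
  have hBm : Measurable B := (hW.pow_const p).mul (hV.pow_const _)
  -- `W` is a geometric mean of `V` and `B`, so Hölder bounds `S W = W` by the same mean of `S V =
  -- V` and `S B`. Solving for `B` uses `0 < V < ∞`.
  have hWB : W = fun x => V x ^ (1 - 1 / p) * B x ^ (1 / p) := by
    funext x
    rw [hB, ENNReal.mul_rpow_of_nonneg _ _ (by positivity), ← ENNReal.rpow_mul,
      ← ENNReal.rpow_mul, mul_one_div_cancel hp0.ne', ENNReal.rpow_one, mul_left_comm,
      ← ENNReal.rpow_add _ _ (hV0 x) (hVt x)]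
    have : 1 - 1 / p + (1 - p) * (1 / p) = 0 := by field_simp; ring
    rw [this, ENNReal.rpow_zero, mul_one]
  have hsub : B ≤ᵐ[Q₀] weightedOp Q β k B := by
    filter_upwards [hVfix, hWfix] with x hVx hWx
    have h1 := weightedOp_mul_rpow_le (Q := Q) hβ0.le hk hV hBm (a := 1 - 1 / p) (b := 1 / p)
      (by rw [sub_nonneg, div_le_one hp0]; exact hp) (by positivity) (by ring) x
    rw [← hWB, hWx, hVx] at h1
    calc B x ≤ (V x ^ (1 - 1 / p) * weightedOp Q β k B x ^ (1 / p)) ^ p * V x ^ (1 - p) := by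
          simp only [hB]; gcongr
      _ = weightedOp Q β k B x := by
          rw [ENNReal.mul_rpow_of_nonneg _ _ hp0.le, ← ENNReal.rpow_mul, ← ENNReal.rpow_mul,
            one_div_mul_cancel hp0.ne', ENNReal.rpow_one, mul_right_comm,
            ← ENNReal.rpow_add _ _ (hV0 x) (hVt x)]
          have : (1 - 1 / p) * p + (1 - p) = 0 := by field_simp; ring
          rw [this, ENNReal.rpow_zero, one_mul]
  exact le_of_le_weighted_self hβ0 hβ1 hfin
    ((lintegral_mono_ae hsub).trans (lintegral_weightedOp_le hQ hβ0 hβ1 hk hBm))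

/-- The reciprocal of a fixed point of `weightedOp` is a subsolution for the reciprocal weight. -/
theorem inv_le_weightedOp_inv [IsMarkovKernel Q] (hk : Measurable k) (hk0 : ∀ p, k p ≠ 0)
    (hkt : ∀ p, k p ≠ ∞) (hh : Measurable h) (hfix : weightedOp Q β k h = h) : h⁻¹ ≤ weightedOp Q β k⁻¹ h⁻¹ := by
  intro x
  have hkx : Measurable fun y => k (x, y) := hk.comp measurable_prodMk_left
  have h1 := inv_lintegral_le_lintegral_inv (Q x) (F := fun y => k (x, y) * h y ^ β) (by fun_prop)
  have h2 : ∫⁻ y, k (x, y) * h y ^ β ∂(Q x) = h x := congrFun hfix x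
  rw [h2] at h1
  refine h1.trans (le_of_eq (lintegral_congr fun y => ?_))
  rw [ENNReal.mul_inv (Or.inl (hk0 _)) (Or.inl (hkt _)), Pi.inv_apply, Pi.inv_apply,
    ENNReal.inv_rpow]

end

/-! ### Exponential moments and Orlicz hearts. -/

/-- The function `f` satisfies `E^μ[exp((|f| / c) ^ s)] < ∞` for all `c > 0`; for probability
measures this describes membership in the Orlicz heart on representatives. -/
def HasExpMoments {Ω : Type*} [MeasurableSpace Ω] (μ : Measure Ω) (s : ℝ) (f : Ω → ℝ) : Prop :=
  ∀ c : ℝ, 0 < c → ∫⁻ ω, ENNReal.ofReal (Real.exp ((|f ω| / c) ^ s)) ∂μ < ∞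

section

variable {Ω : Type*} [MeasurableSpace Ω] {μ : Measure Ω} {s : ℝ} {f g : Ω → ℝ}

/-- The integrands differ by the constant `1`, which is integrable for a finite measure. -/
theorem mem_orliczHeart_iff_hasExpMoments [IsFiniteMeasure μ] (hs : 1 ≤ s) (F : Ω →ₘ[μ] ℝ) :
    F ∈ orliczHeart μ s ↔ HasExpMoments μ s F := by
  rw [mem_orliczHeart_iff hs]
  refine forall₂_congr fun c hc => ?_
  have e : ∀ ω, ENNReal.ofReal (Real.exp ((|F ω| / c) ^ s))
      = ENNReal.ofReal (orliczPhi s (|F ω| / c)) + 1 := by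
    intro ω
    rw [← ENNReal.ofReal_one, ← ENNReal.ofReal_add _ zero_le_one]
    · simp [orliczPhi]
    · have : 0 ≤ (|F ω| / c) ^ s := by positivity
      simpa [orliczPhi] using this
  simp only [e]
  rw [lintegral_add_right _ measurable_const, ENNReal.add_lt_top]
  simp [orliczModular]

theorem HasExpMoments.mono_ae (hs : 0 ≤ s) (hg : HasExpMoments μ s g)
    (h : ∀ᵐ ω ∂μ, |f ω| ≤ |g ω|) : HasExpMoments μ s f := fun c hc => by
  refine lt_of_le_of_lt (lintegral_mono_ae ?_) (hg c hc)
  filter_upwards [h] with ω hω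
  gcongr

theorem HasExpMoments.const_mul (hs : 0 ≤ s) (hf : HasExpMoments μ s f) (a : ℝ) :
    HasExpMoments μ s (fun ω => a * f ω) := fun c hc => by
  -- `|a| + 1` replaces `|a|` so that the rescaled `c` makes sense when `a = 0`.
  have ha : 0 < |a| + 1 := by positivity
  refine lt_of_le_of_lt (lintegral_mono fun ω => ?_) (hf (c / (|a| + 1)) (by positivity))
  have : |a * f ω| / c ≤ |f ω| / (c / (|a| + 1)) := by
    rw [abs_mul, div_div_eq_mul_div, mul_comm]
    gcongr
    linarith
  gcongr

theorem HasExpMoments.add (hs : 0 ≤ s) (hfm : Measurable f) (hf : HasExpMoments μ s f)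
    (hg : HasExpMoments μ s g) : HasExpMoments μ s (fun ω => |f ω| + |g ω|) := fun c hc => by
  have hc2 : 0 < c / 2 := by positivity
  refine lt_of_le_of_lt ?_ (ENNReal.add_lt_top.2 ⟨hf (c / 2) hc2, hg (c / 2) hc2⟩)
  rw [← lintegral_add_left (by fun_prop)]
  refine lintegral_mono fun ω => ?_
  simp only []
  rw [abs_of_nonneg (by positivity : 0 ≤ |f ω| + |g ω|)]
  -- The sum is at most twice the larger term, and `c / 2` absorbs the factor.
  rcases le_total |f ω| |g ω| with h | h
  · refine le_trans ?_ le_add_self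
    have : (|f ω| + |g ω|) / c ≤ |g ω| / (c / 2) := by
      rw [div_div_eq_mul_div]; gcongr; linarith
    gcongr
  · refine le_trans ?_ le_self_add
    have : (|f ω| + |g ω|) / c ≤ |f ω| / (c / 2) := by
      rw [div_div_eq_mul_div]; gcongr; linarith
    gcongr

theorem rpow_le_one_add_rpow {x p q : ℝ} (hx : 0 ≤ x) (hp : 0 ≤ p) (hpq : p ≤ q) :
    x ^ p ≤ 1 + x ^ q := by
  rcases le_total x 1 with h | h
  · linarith [Real.rpow_le_one hx h hp, Real.rpow_nonneg hx q]
  · linarith [Real.rpow_le_rpow_of_exponent_le h hpq]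

theorem HasExpMoments.mono_exponent (hf : HasExpMoments μ s f) {p : ℝ} (hp : 0 ≤ p)
    (hps : p ≤ s) : HasExpMoments μ p f := fun c hc => by
  refine lt_of_le_of_lt ((lintegral_mono fun ω => ?_).trans_eq
    (lintegral_const_mul' (ENNReal.ofReal (Real.exp 1)) _ ENNReal.ofReal_ne_top))
    (ENNReal.mul_lt_top ENNReal.ofReal_lt_top (hf c hc))
  rw [← ENNReal.ofReal_mul (Real.exp_pos _).le, ← Real.exp_add]
  gcongr
  exact rpow_le_one_add_rpow (by positivity) hp hps

theorem HasExpMoments.lintegral_exp_lt_top (hs : 1 ≤ s) (hf : HasExpMoments μ s f) :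
    ∫⁻ ω, ENNReal.ofReal (Real.exp (f ω)) ∂μ < ∞ := by
  refine lt_of_le_of_lt (lintegral_mono fun ω => ?_)
    (hf.mono_exponent zero_le_one hs 1 one_pos)
  rw [div_one, Real.rpow_one]
  gcongr
  exact le_abs_self _

end

/-! ### Entropic conditional means. -/

section

variable {X : Type*} [MeasurableSpace X] {Q : Kernel X X} [IsMarkovKernel Q] {Q₀ : Measure X}
  [IsProbabilityMeasure Q₀]

theorem HasExpMoments.comp_snd (hQ : Kernel.Invariant Q Q₀) {s : ℝ} {f : X → ℝ}
    (hfm : Measurable f) (hf : HasExpMoments Q₀ s f) :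
    HasExpMoments (Q₀ ⊗ₘ Q) s (fun p => f p.2) := fun c hc => by
  rw [lintegral_compProd_snd hQ (h := fun y => ENNReal.ofReal (Real.exp ((|f y| / c) ^ s)))
    (by fun_prop)]
  exact hf c hc

theorem lintegral_exp_rpow_log_le {Y : X × X → ℝ} (hY : Measurable Y) (hY0 : ∀ p, 0 ≤ Y p)
    {r c : ℝ} (hr : 1 ≤ r) (hc : 0 < c) :
    ∫⁻ x, ENNReal.ofReal (Real.exp
        ((Real.log (∫⁻ y, ENNReal.ofReal (Real.exp (Y (x, y))) ∂(Q x)).toReal / c) ^ r)) ∂Q₀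
      ≤ ∫⁻ p, ENNReal.ofReal (Real.exp (Y p)) ∂(Q₀ ⊗ₘ Q)
        + ∫⁻ p, ENNReal.ofReal (Real.exp ((Y p / c) ^ r)) ∂(Q₀ ⊗ₘ Q) := by
  have h1 : Measurable fun p : X × X => ENNReal.ofReal (Real.exp (Y p)) := by fun_prop
  have h2 : Measurable fun p : X × X => ENNReal.ofReal (Real.exp ((Y p / c) ^ r)) := by fun_prop
  rw [Measure.lintegral_compProd h1, Measure.lintegral_compProd h2,
    ← lintegral_add_left h1.lintegral_kernel_prod_right']
  exact lintegral_mono fun x => exp_rpow_log_lintegral_le (Q x)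
    (hY.comp measurable_prodMk_left) (fun y => hY0 _) hr hc

/-- The upper bound is monotonicity. The lower one is `E[exp Z] ≥ 1 / E[exp(-Z)] ≥ 1 / E[exp Y]`, by
the harmonic mean inequality. -/
theorem abs_log_lintegral_exp_le {Ω : Type*} [MeasurableSpace Ω] (P : Measure Ω)
    [IsProbabilityMeasure P] {Z Y : Ω → ℝ} (hZ : Measurable Z) (hZY : ∀ ω, |Z ω| ≤ Y ω)
    (hfin : ∫⁻ ω, ENNReal.ofReal (Real.exp (Y ω)) ∂P ≠ ∞) :
    |Real.log (∫⁻ ω, ENNReal.ofReal (Real.exp (Z ω)) ∂P).toReal| ≤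
      Real.log (∫⁻ ω, ENNReal.ofReal (Real.exp (Y ω)) ∂P).toReal := by
  set z := ∫⁻ ω, ENNReal.ofReal (Real.exp (Z ω)) ∂P
  set y := ∫⁻ ω, ENNReal.ofReal (Real.exp (Y ω)) ∂P
  have hzy : z ≤ y := lintegral_mono fun ω => by
    gcongr; exact (le_abs_self _).trans (hZY ω)
  have hyz : y⁻¹ ≤ z := by
    have h1 := inv_lintegral_le_lintegral_inv P (F := fun ω => ENNReal.ofReal (Real.exp (-Z ω)))
      (by fun_prop)
    have h2 : ∫⁻ ω, (ENNReal.ofReal (Real.exp (-Z ω)))⁻¹ ∂P = z := lintegral_congr fun ω => by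
      rw [← ENNReal.ofReal_inv_of_pos (Real.exp_pos _), ← Real.exp_neg, neg_neg]
    rw [h2] at h1
    refine le_trans (ENNReal.inv_le_inv.2 (lintegral_mono fun ω => ?_)) h1
    gcongr
    exact (neg_le_abs _).trans (hZY ω)
  have hz0 : z ≠ 0 := fun h => by
    rw [h, nonpos_iff_eq_zero, ENNReal.inv_eq_zero] at hyz
    exact hfin hyz
  have hzt : z ≠ ∞ := ne_top_of_le_ne_top hfin hzy
  have hzp : 0 < z.toReal := ENNReal.toReal_pos hz0 hzt
  have hyp : 0 < y.toReal := ENNReal.toReal_pos (fun h => hz0 (by simpa [h] using hzy)) hfin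
  rw [abs_le']
  refine ⟨Real.log_le_log hzp (ENNReal.toReal_mono hfin hzy), ?_⟩
  rw [← Real.log_inv]
  refine Real.log_le_log (by positivity) ?_
  rw [inv_le_comm₀ hzp hyp, ← ENNReal.toReal_inv]
  exact ENNReal.toReal_mono hzt hyz

/-- Entropic conditional means of functions with exponential moments are finite almost everywhere
and have exponential moments. -/
theorem HasExpMoments.log_lintegral {s : ℝ} (hs : 1 ≤ s) {Z Y : X × X → ℝ} (hZ : Measurable Z)
    (hY : Measurable Y) (hZY : ∀ p, |Z p| ≤ Y p) (h : HasExpMoments (Q₀ ⊗ₘ Q) s Y) :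
    (∀ᵐ x ∂Q₀, ∫⁻ y, ENNReal.ofReal (Real.exp (Z (x, y))) ∂(Q x) < ∞) ∧
    HasExpMoments Q₀ s
      (fun x => Real.log (∫⁻ y, ENNReal.ofReal (Real.exp (Z (x, y))) ∂(Q x)).toReal) := by
  have hY0 : ∀ p, 0 ≤ Y p := fun p => (abs_nonneg _).trans (hZY p)
  have hYm : Measurable fun p : X × X => ENNReal.ofReal (Real.exp (Y p)) := by fun_prop
  have h1 := h.lintegral_exp_lt_top hs
  have h2 := h1
  rw [Measure.lintegral_compProd hYm] at h2
  have h3 := ae_lt_top hYm.lintegral_kernel_prod_right' h2.ne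
  constructor
  · filter_upwards [h3] with x hx
    refine lt_of_le_of_lt (lintegral_mono fun y => ?_) hx
    gcongr
    exact (le_abs_self _).trans (hZY _)
  · intro c hc
    refine lt_of_le_of_lt ((lintegral_mono_ae ?_).trans
      (lintegral_exp_rpow_log_le (Q := Q) (Q₀ := Q₀) hY hY0 hs hc))
      (ENNReal.add_lt_top.2 ⟨h1, ?_⟩)
    · filter_upwards [h3] with x hx
      have := abs_log_lintegral_exp_le (Q x) (Z := fun y => Z (x, y)) (Y := fun y => Y (x, y))
        (hZ.comp measurable_prodMk_left) (fun y => hZY _) hx.ne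
      gcongr
    · simpa only [abs_of_nonneg (hY0 _)] using h c hc

end

/-! ### The exponential change of variables. -/

section

variable {X : Type*} [MeasurableSpace X] {Q : Kernel X X}

theorem continuationFun_eq (β α : ℝ) {u : X × X → ℝ} (hu : Measurable u)
    {f : X → ℝ} (hf : Measurable f) (x : X) :
    continuationFun Q β α u f x =
      β * Real.log (∫⁻ y, ENNReal.ofReal (Real.exp (f y + α * u (x, y))) ∂(Q x)).toReal := by
  rw [continuationFun, integral_eq_lintegral_of_nonneg_ae]
  · exact ae_of_all _ fun y => (Real.exp_pos _).le
  · exact (by fun_prop : Measurable fun y => Real.exp (f y + α * u (x, y))).aestronglyMeasurable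

theorem weightedOp_ofReal_exp {β : ℝ} (hβ : β ≠ 0) (g : X × X → ℝ) (f : X → ℝ) (x : X) :
    weightedOp Q β (fun p => ENNReal.ofReal (Real.exp (g p)))
      (fun y => ENNReal.ofReal (Real.exp (f y / β))) x =
      ∫⁻ y, ENNReal.ofReal (Real.exp (f y + g (x, y))) ∂(Q x) := by
  refine lintegral_congr fun y => ?_
  rw [ENNReal.ofReal_rpow_of_pos (Real.exp_pos _), ← Real.exp_mul, div_mul_cancel₀ _ hβ,
    ← ENNReal.ofReal_mul (Real.exp_pos _).le, ← Real.exp_add, add_comm]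

end

/-! ### The majorant for a nonnegative exponent. -/

section

variable {X : Type*} [MeasurableSpace X] {Q : Kernel X X} [IsMarkovKernel Q] {Q₀ : Measure X}
  [IsProbabilityMeasure Q₀] {β : ℝ}

/-- One step of the modular estimate along the orbit of `weightedOp`. -/
theorem lintegral_exp_rpow_log_weightedOp_le (hQ : Kernel.Invariant Q Q₀) (hβ0 : 0 < β)
    (hβ1 : β < 1) {G : X × X → ℝ} (hG : Measurable G) (hG0 : ∀ p, 0 ≤ G p) {h : X → ℝ≥0∞}
    (hh : Measurable h) (h1 : ∀ x, 1 ≤ h x) (hfin : ∫⁻ x, h x ∂Q₀ ≠ ∞) {r c : ℝ} (hr : 1 ≤ r)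
    (hc : 0 < c) :
    ∫⁻ x, ENNReal.ofReal (Real.exp ((Real.log (weightedOp Q β
        (fun p => ENNReal.ofReal (Real.exp (G p))) h x).toReal / c) ^ r)) ∂Q₀
      ≤ ∫⁻ x, weightedOp Q β (fun p => ENNReal.ofReal (Real.exp (G p))) h x ∂Q₀
        + (ENNReal.ofReal (1 - β) *
            ∫⁻ p, ENNReal.ofReal (Real.exp ((G p / ((1 - β) * c)) ^ r)) ∂(Q₀ ⊗ₘ Q)
          + ENNReal.ofReal β *
            ∫⁻ x, ENNReal.ofReal (Real.exp ((Real.log (h x).toReal / c) ^ r)) ∂Q₀) := by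
  set k : X × X → ℝ≥0∞ := fun p => ENNReal.ofReal (Real.exp (G p)) with hk
  have hkm : Measurable k := by fun_prop
  set f : X → ℝ := fun x => β * Real.log (h x).toReal with hf
  have hfm : Measurable f := (Real.measurable_log.comp hh.ennreal_toReal).const_mul β
  have hhf : h =ᵐ[Q₀] fun y => ENNReal.ofReal (Real.exp (f y / β)) := by
    filter_upwards [ae_lt_top hh hfin] with y hy
    have : 0 < (h y).toReal := ENNReal.toReal_pos (one_pos.trans_le (h1 y)).ne' hy.ne
    rw [hf, mul_div_cancel_left₀ _ hβ0.ne', Real.exp_log this, ENNReal.ofReal_toReal hy.ne]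
  have hf0 : ∀ y, 0 ≤ f y := fun y => by
    refine mul_nonneg hβ0.le ?_
    -- Where `h = ∞`, the conventions `toReal ∞ = 0` and `log 0 = 0` give `f = 0`.
    by_cases hy : h y = ∞
    · simp [hy]
    · exact Real.log_nonneg (by simpa using ENNReal.toReal_mono hy (h1 y))
  have hS : weightedOp Q β k h =ᵐ[Q₀]
      fun x => ∫⁻ y, ENNReal.ofReal (Real.exp (f y + G (x, y))) ∂(Q x) := by
    filter_upwards [weightedOp_congr_ae (k := k) hQ hβ0.le hhf] with x hx
    rw [hx, hk, weightedOp_ofReal_exp hβ0.ne']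
  set Y : X × X → ℝ := fun p => f p.2 + G p with hY
  have hYm : Measurable Y := by fun_prop
  have key := lintegral_exp_rpow_log_le (Q := Q) (Q₀ := Q₀) hYm
    (fun p => add_nonneg (hf0 _) (hG0 _)) hr hc
  have e1 : ∫⁻ p, ENNReal.ofReal (Real.exp (Y p)) ∂(Q₀ ⊗ₘ Q)
      = ∫⁻ x, weightedOp Q β k h x ∂Q₀ := by
    rw [Measure.lintegral_compProd (by fun_prop), lintegral_congr_ae hS]
  have e2 : ∫⁻ x, ENNReal.ofReal (Real.exp ((Real.log (weightedOp Q β k h x).toReal / c) ^ r)) ∂Q₀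
      = ∫⁻ x, ENNReal.ofReal (Real.exp ((Real.log
          (∫⁻ y, ENNReal.ofReal (Real.exp (Y (x, y))) ∂(Q x)).toReal / c) ^ r)) ∂Q₀ := by
    refine lintegral_congr_ae ?_
    filter_upwards [hS] with x hx
    rw [hx]
  rw [e2, ← e1]
  refine key.trans ?_
  gcongr
  -- Since `f / (β c) = log h / c`, the convex splitting returns the modular of `log h` at the same
  -- `c`, with factor `β`.
  have e3 : ∫⁻ x, ENNReal.ofReal (Real.exp ((Real.log (h x).toReal / c) ^ r)) ∂Q₀
      = ∫⁻ p, ENNReal.ofReal (Real.exp ((f p.2 / (β * c)) ^ r)) ∂(Q₀ ⊗ₘ Q) := by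
    rw [lintegral_compProd_snd hQ
      (h := fun y => ENNReal.ofReal (Real.exp ((f y / (β * c)) ^ r))) (by fun_prop)]
    refine lintegral_congr fun y => ?_
    rw [hf, mul_div_mul_left _ _ hβ0.ne']
  rw [e3, ← lintegral_const_mul' _ _ ENNReal.ofReal_ne_top,
    ← lintegral_const_mul' _ _ ENNReal.ofReal_ne_top, ← lintegral_add_left (by fun_prop)]
  refine lintegral_mono fun p => ?_
  rw [← ENNReal.ofReal_mul (by linarith), ← ENNReal.ofReal_mul hβ0.le,
    ← ENNReal.ofReal_add (mul_nonneg (by linarith) (Real.exp_pos _).le)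
      (mul_nonneg hβ0.le (Real.exp_pos _).le)]
  refine ENNReal.ofReal_le_ofReal ?_
  simp only [hY, add_comm (f p.2)]
  exact exp_rpow_add_le hr hc hβ0 hβ1 (hG0 p) (hf0 _)

/-- For a weight `exp G` with `G ≥ 0` in the Orlicz heart, `weightedOp` has a fixed point `H ≥ 1`
whose logarithm is in the Orlicz heart. -/
theorem exists_weightedOp_majorant (hQ : Kernel.Invariant Q Q₀) (hβ0 : 0 < β) (hβ1 : β < 1)
    {G : X × X → ℝ} (hG : Measurable G) (hG0 : ∀ p, 0 ≤ G p) {r : ℝ} (hr : 1 ≤ r)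
    (hGr : HasExpMoments (Q₀ ⊗ₘ Q) r G) :
    ∃ H : X → ℝ≥0∞, Measurable H ∧ (∀ x, 1 ≤ H x) ∧
      weightedOp Q β (fun p => ENNReal.ofReal (Real.exp (G p))) H = H ∧
      ∫⁻ x, H x ∂Q₀ ≠ ∞ ∧ HasExpMoments Q₀ r (fun x => Real.log (H x).toReal) := by
  have hβ : 0 < 1 - β := by linarith
  set k : X × X → ℝ≥0∞ := fun p => ENNReal.ofReal (Real.exp (G p)) with hk
  have hkm : Measurable k := by fun_prop
  have hk1 : ∀ p, 1 ≤ k p := fun p => by simpa [hk] using hG0 p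
  have hsub : (1 : X → ℝ≥0∞) ≤ weightedOp Q β k 1 := fun x => by
    calc (1 : ℝ≥0∞) = ∫⁻ _, 1 ∂(Q x) := by simp
      _ ≤ _ := lintegral_mono fun y => by simpa using hk1 (x, y)
  obtain ⟨hm, hmono, hfix⟩ := weightedOp_iSup_iterate (Q := Q) hβ0 hkm measurable_one hsub
  set h : ℕ → X → ℝ≥0∞ := fun n => (weightedOp Q β k)^[n] 1 with hh
  have hsucc : ∀ n, h (n + 1) = weightedOp Q β k (h n) := fun n =>
    Function.iterate_succ_apply' _ _ _
  have h1 : ∀ n x, 1 ≤ h n x := fun n x => hmono (Nat.zero_le n) x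
  have hG' : ∫⁻ p, k p ^ (1 / (1 - β)) ∂(Q₀ ⊗ₘ Q) < ∞ := by
    have e : ∀ p, k p ^ (1 / (1 - β)) = ENNReal.ofReal (Real.exp (1 / (1 - β) * G p)) := by
      intro p
      rw [hk, ENNReal.ofReal_rpow_of_pos (Real.exp_pos _), ← Real.exp_mul, mul_comm]
    simp only [e]
    exact (hGr.const_mul (by linarith) _).lintegral_exp_lt_top hr
  -- The `1` starts the induction at `h 0 = 1`; the other entry makes the bound stable under `S`.
  set N : ℝ≥0∞ := max 1 (∫⁻ p, k p ^ (1 / (1 - β)) ∂(Q₀ ⊗ₘ Q)) with hN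
  have hNt : N < ∞ := max_lt ENNReal.one_lt_top hG'
  have hbound : ∀ n, ∫⁻ x, h n x ∂Q₀ ≤ N := by
    intro n
    induction n with
    | zero => simp [hh, hN]
    | succ n ih =>
      rw [hsucc]
      exact (lintegral_weightedOp_le hQ hβ0 hβ1 hkm (hm n)).trans
        (weighted_le hβ0 hβ1 (le_max_right _ _) ih)
  have hHint : ∫⁻ x, (⨆ n, h n) x ∂Q₀ ≤ N := by
    simp only [iSup_apply]
    rw [lintegral_iSup hm hmono]
    exact iSup_le hbound
  have hHm : Measurable (⨆ n, h n) := by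
    have := Measurable.iSup hm
    convert this using 1
    funext x
    simp [hh]
  have hH1 : ∀ x, 1 ≤ (⨆ n, h n) x := fun x => by
    rw [iSup_apply]
    exact (h1 0 x).trans (le_iSup (fun n => h n x) 0)
  refine ⟨⨆ n, h n, hHm, hH1, hfix, (hHint.trans_lt hNt).ne, fun c hc => ?_⟩
  set A : ℝ≥0∞ := ∫⁻ p, ENNReal.ofReal (Real.exp ((G p / ((1 - β) * c)) ^ r)) ∂(Q₀ ⊗ₘ Q) with hA
  have hAt : A < ∞ := by
    simpa only [abs_of_nonneg (hG0 _)] using hGr ((1 - β) * c) (by positivity)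
  -- Chosen so that `N + (1 - β) A + β K ≤ K`, which closes the recursion.
  set K : ℝ≥0∞ := max 1 ((ENNReal.ofReal (1 - β))⁻¹ * N + A) with hK
  have hβt : ENNReal.ofReal (1 - β) ≠ 0 := by simpa using hβ1
  have hKt : K < ∞ := max_lt ENNReal.one_lt_top (ENNReal.add_lt_top.2
    ⟨ENNReal.mul_lt_top (by simpa using hβ1) hNt, hAt⟩)
  have hmod : ∀ n, ∫⁻ x, ENNReal.ofReal
      (Real.exp ((Real.log (h n x).toReal / c) ^ r)) ∂Q₀ ≤ K := by
    intro n
    induction n with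
    | zero =>
      simp [hh, hK, Real.zero_rpow (by linarith : r ≠ 0)]
    | succ n ih =>
      rw [hsucc]
      refine (lintegral_exp_rpow_log_weightedOp_le hQ hβ0 hβ1 hG hG0 (hm n) (h1 n)
        ((hbound n).trans_lt hNt).ne hr hc).trans ?_
      rw [← hA, ← hk, ← hsucc, ← add_assoc]
      refine le_trans ?_ (weighted_le hβ0 hβ1 (le_max_right _ _) ih)
      gcongr
      rw [mul_add, ← mul_assoc, ENNReal.mul_inv_cancel hβt ENNReal.ofReal_ne_top, one_mul]
      gcongr
      exact hbound (n + 1)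
  refine lt_of_le_of_lt ?_ hKt
  -- Fatou's lemma; the integrands converge where `H < ∞`, since `H ≥ 1` keeps the logarithm
  -- continuous there.
  calc ∫⁻ x, ENNReal.ofReal (Real.exp ((|Real.log ((⨆ n, h n) x).toReal| / c) ^ r)) ∂Q₀
      ≤ ∫⁻ x, Filter.liminf (fun n => ENNReal.ofReal
          (Real.exp ((Real.log (h n x).toReal / c) ^ r))) Filter.atTop ∂Q₀ := by
        refine lintegral_mono_ae ?_
        filter_upwards [ae_lt_top hHm (hHint.trans_lt hNt).ne] with x hx
        have hone : 1 ≤ ((⨆ n, h n) x).toReal := by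
          simpa using ENNReal.toReal_mono hx.ne (hH1 x)
        rw [abs_of_nonneg (Real.log_nonneg hone)]
        have ht : Filter.Tendsto (fun n => h n x) Filter.atTop (nhds ((⨆ n, h n) x)) := by
          rw [iSup_apply]
          exact tendsto_atTop_iSup fun m n hmn => hmono hmn x
        have ht2 := ((((ENNReal.tendsto_toReal hx.ne).comp ht).log (by linarith)).div_const
          c).rpow_const (p := r) (Or.inr (by linarith))
        exact (ENNReal.tendsto_ofReal (Real.continuous_exp.continuousAt.tendsto.comp
          ht2)).liminf_eq.ge
    _ ≤ Filter.liminf (fun n => ∫⁻ x, ENNReal.ofReal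
          (Real.exp ((Real.log (h n x).toReal / c) ^ r)) ∂Q₀) Filter.atTop :=
        lintegral_liminf_le fun n => by
          have := (hm n).ennreal_toReal
          fun_prop
    _ ≤ K := Filter.liminf_le_of_le (by isBoundedDefault) fun b hb => by
        obtain ⟨n, hn⟩ := hb.exists
        exact hn.trans (hmod n)

end

/-! ### Existence and uniqueness of the fixed point. -/

section

variable {X : Type*} [MeasurableSpace X] {Q : Kernel X X} [IsMarkovKernel Q] {Q₀ : Measure X}
  [IsProbabilityMeasure Q₀] {β : ℝ}

/-- The majorant `H` for `exp |g|` traps the orbit of `H⁻¹` between `H⁻¹` and `H`, because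
`exp(-|g|) ≤ exp g ≤ exp |g|`. -/
theorem exists_weightedOp_fixedPoint (hQ : Kernel.Invariant Q Q₀) (hβ0 : 0 < β) (hβ1 : β < 1)
    {g : X × X → ℝ} (hg : Measurable g) {r : ℝ} (hr : 1 ≤ r)
    (hgr : HasExpMoments (Q₀ ⊗ₘ Q) r g) :
    ∃ V : X → ℝ≥0∞, Measurable V ∧ (∀ᵐ x ∂Q₀, V x ≠ 0 ∧ V x ≠ ∞) ∧
      weightedOp Q β (fun p => ENNReal.ofReal (Real.exp (g p))) V = V ∧
      HasExpMoments Q₀ r (fun x => Real.log (V x).toReal) := by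
  obtain ⟨H, hHm, hH1, hHfix, hHint, hHr⟩ := exists_weightedOp_majorant hQ hβ0 hβ1
    (G := fun p => |g p|) (by fun_prop) (fun p => abs_nonneg _) hr
    (hgr.mono_ae (by linarith) (ae_of_all _ fun p => (abs_abs _).le))
  set K : X × X → ℝ≥0∞ := fun p => ENNReal.ofReal (Real.exp |g p|) with hK
  set k : X × X → ℝ≥0∞ := fun p => ENNReal.ofReal (Real.exp (g p)) with hk
  have hKm : Measurable K := by fun_prop
  have hkm : Measurable k := by fun_prop
  have hkK : k ≤ K := fun p => ENNReal.ofReal_le_ofReal (Real.exp_le_exp.2 (le_abs_self _))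
  have hKk : K⁻¹ ≤ k := fun p => by
    rw [Pi.inv_apply, hK, ← ENNReal.ofReal_inv_of_pos (Real.exp_pos _), ← Real.exp_neg]
    exact ENNReal.ofReal_le_ofReal (Real.exp_le_exp.2 (neg_abs_le _))
  have hsub : H⁻¹ ≤ weightedOp Q β k H⁻¹ :=
    (inv_le_weightedOp_inv hKm (fun p => by simp [hK, Real.exp_pos])
      (fun p => ENNReal.ofReal_ne_top) hHm hHfix).trans (weightedOp_mono hβ0.le hKk le_rfl)
  obtain ⟨hm, hmono, hfix⟩ := weightedOp_iSup_iterate (Q := Q) hβ0 hkm hHm.inv hsub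
  have hle : ∀ n, (weightedOp Q β k)^[n] H⁻¹ ≤ H := by
    intro n
    induction n with
    | zero => exact fun x => (ENNReal.inv_le_one.2 (hH1 x)).trans (hH1 x)
    | succ n ih =>
      rw [Function.iterate_succ_apply']
      exact (weightedOp_mono hβ0.le hkK ih).trans hHfix.le
  set V := ⨆ n, (weightedOp Q β k)^[n] H⁻¹ with hV
  have hVH : V ≤ H := iSup_le hle
  have hHV : H⁻¹ ≤ V := le_iSup (fun n => (weightedOp Q β k)^[n] H⁻¹) 0
  have hVm : Measurable V := by
    convert Measurable.iSup hm using 1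
    funext x
    simp [hV]
  have hpos : ∀ᵐ x ∂Q₀, H x ≠ ∞ ∧ V x ≠ 0 ∧ V x ≠ ∞ := by
    filter_upwards [ae_lt_top hHm hHint] with x hx
    refine ⟨hx.ne, fun h0 => ?_, ne_top_of_le_ne_top hx.ne (hVH x)⟩
    have := hHV x
    rw [h0, Pi.inv_apply, nonpos_iff_eq_zero, ENNReal.inv_eq_zero] at this
    exact hx.ne this
  refine ⟨V, hVm, hpos.mono fun x hx => hx.2, hfix, hHr.mono_ae (by linarith) ?_⟩
  filter_upwards [hpos] with x ⟨hHt, hV0, hVt⟩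
  refine le_trans ?_ (le_abs_self _)
  have hVp : 0 < (V x).toReal := ENNReal.toReal_pos hV0 hVt
  have hHp : 0 < (H x).toReal := ENNReal.toReal_pos (one_pos.trans_le (hH1 x)).ne' hHt
  refine abs_le'.2 ⟨Real.log_le_log hVp (ENNReal.toReal_mono hHt (hVH x)), ?_⟩
  rw [← Real.log_inv]
  refine Real.log_le_log (by positivity) ?_
  rw [inv_le_comm₀ hVp hHp, ← ENNReal.toReal_inv]
  exact ENNReal.toReal_mono hVt (hHV x)

/-- `T` maps functions with exponential moments to functions with exponential moments. -/
theorem hasExpMoments_continuationFun (hQ : Kernel.Invariant Q Q₀) (α : ℝ) {s : ℝ} (hs : 1 ≤ s)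
    {u : X × X → ℝ} (hu : Measurable u) (hus : HasExpMoments (Q₀ ⊗ₘ Q) s u) {f : X → ℝ}
    (hf : Measurable f) (hfs : HasExpMoments Q₀ s f) :
    (∀ᵐ x ∂Q₀, ∫⁻ y, ENNReal.ofReal (Real.exp (f y + α * u (x, y))) ∂(Q x) < ∞) ∧
    HasExpMoments Q₀ s (continuationFun Q β α u f) := by
  have hs0 : 0 ≤ s := by linarith
  have h := HasExpMoments.log_lintegral (Q := Q) (Q₀ := Q₀) hs
    (Z := fun p => f p.2 + α * u p) (Y := fun p => |f p.2| + |α * u p|) (by fun_prop)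
    (by fun_prop) (fun p => abs_add_le _ _)
    ((hfs.comp_snd hQ hf).add hs0 (by fun_prop) (hus.const_mul hs0 α))
  refine ⟨h.1, ?_⟩
  have e : continuationFun Q β α u f = fun x => β * Real.log
      (∫⁻ y, ENNReal.ofReal (Real.exp (f y + α * u (x, y))) ∂(Q x)).toReal :=
    funext fun x => continuationFun_eq β α hu hf x
  rw [e]
  exact h.2.const_mul hs0 β

/-- A fixed point of `T` with exponential moments gives a fixed point of `weightedOp`. -/
theorem weightedOp_exp_of_continuationFun_eq (hQ : Kernel.Invariant Q Q₀) (hβ0 : 0 < β) (α : ℝ)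
    {s : ℝ} (hs : 1 ≤ s) {u : X × X → ℝ} (hu : Measurable u)
    (hus : HasExpMoments (Q₀ ⊗ₘ Q) s u) {f : X → ℝ} (hf : Measurable f)
    (hfs : HasExpMoments Q₀ s f) (hfix : continuationFun Q β α u f =ᵐ[Q₀] f) :
    weightedOp Q β (fun p => ENNReal.ofReal (Real.exp (α * u p)))
      (fun y => ENNReal.ofReal (Real.exp (f y / β))) =ᵐ[Q₀]
      fun y => ENNReal.ofReal (Real.exp (f y / β)) := by
  filter_upwards [(hasExpMoments_continuationFun (β := β) hQ α hs hu hus hf hfs).1, hfix] with x hx1 hx2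
  rw [weightedOp_ofReal_exp hβ0.ne', ← hx2, continuationFun_eq β α hu hf x,
    mul_div_cancel_left₀ _ hβ0.ne']
  have hne : ∫⁻ y, ENNReal.ofReal (Real.exp (f y + α * u (x, y))) ∂(Q x) ≠ 0 := by
    rw [← pos_iff_ne_zero, lintegral_pos_iff_support (by fun_prop)]
    have : Function.support (fun y => ENNReal.ofReal (Real.exp (f y + α * u (x, y))))
        = Set.univ := by
      ext y; simp [Real.exp_pos]
    simp [this]
  rw [Real.exp_log (ENNReal.toReal_pos hne hx1.ne), ENNReal.ofReal_toReal hx1.ne]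

/-- If `E[exp(p d + e)]` is bounded in `p`, then `d ≤ 0` almost everywhere. -/
theorem ae_nonpos_of_lintegral_exp_bounded {Ω : Type*} [MeasurableSpace Ω] {μ : Measure Ω}
    {d e : Ω → ℝ} (hd : Measurable d) (he : Measurable e) {C : ℝ≥0∞} (hC : C ≠ ∞)
    (h : ∀ n : ℕ, ∫⁻ ω, ENNReal.ofReal (Real.exp ((n + 1) * d ω + e ω)) ∂μ ≤ C) :
    ∀ᵐ ω ∂μ, d ω ≤ 0 := by
  set F : ℕ → Ω → ℝ≥0∞ := fun n ω => ENNReal.ofReal (Real.exp ((n + 1) * d ω + e ω)) with hF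
  have hFm : ∀ n, Measurable (F n) := fun n => by fun_prop
  -- By Fatou the lower limit is integrable, hence finite almost everywhere; where `d > 0` it is
  -- `∞`.
  have h1 : ∫⁻ ω, Filter.liminf (fun n => F n ω) Filter.atTop ∂μ ≤ C :=
    (lintegral_liminf_le hFm).trans (Filter.liminf_le_of_le (by isBoundedDefault) fun b hb => by
      obtain ⟨n, hn⟩ := hb.exists
      exact hn.trans (h n))
  filter_upwards [ae_lt_top (.liminf hFm) (ne_top_of_le_ne_top hC h1)] with ω hω
  by_contra hd0
  have ht : Filter.Tendsto (fun n => F n ω) Filter.atTop (nhds ∞) := by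
    refine ENNReal.tendsto_ofReal_atTop.comp (Real.tendsto_exp_atTop.comp ?_)
    refine Filter.tendsto_atTop_add_const_right _ _ ?_
    exact (Filter.tendsto_atTop_add_const_right _ _ tendsto_natCast_atTop_atTop).atTop_mul_const
      (not_le.1 hd0)
  exact hω.ne ht.liminf_eq

/-- Any two fixed points `v`, `w` of `T` with exponential moments satisfy `w ≤ v` almost
everywhere; exchanging them gives uniqueness. -/
theorem le_ae_of_continuationFun_eq (hQ : Kernel.Invariant Q Q₀) (hβ0 : 0 < β) (hβ1 : β < 1)
    (α : ℝ) {s : ℝ} (hs : 1 ≤ s) {u : X × X → ℝ} (hu : Measurable u)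
    (hus : HasExpMoments (Q₀ ⊗ₘ Q) s u) {v w : X → ℝ} (hv : Measurable v) (hw : Measurable w)
    (hvs : HasExpMoments Q₀ s v) (hws : HasExpMoments Q₀ s w)
    (hvfix : continuationFun Q β α u v =ᵐ[Q₀] v) (hwfix : continuationFun Q β α u w =ᵐ[Q₀] w) :
    w ≤ᵐ[Q₀] v := by
  have hs0 : 0 ≤ s := by linarith
  have hβ : 0 < 1 - β := by linarith
  have hC : ∫⁻ p, ENNReal.ofReal (Real.exp (α * u p)) ^ (1 / (1 - β)) ∂(Q₀ ⊗ₘ Q) ≠ ∞ := by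
    have e : ∀ p, ENNReal.ofReal (Real.exp (α * u p)) ^ (1 / (1 - β))
        = ENNReal.ofReal (Real.exp (1 / (1 - β) * α * u p)) := by
      intro p
      rw [ENNReal.ofReal_rpow_of_pos (Real.exp_pos _), ← Real.exp_mul]
      ring_nf
    simp only [e]
    exact ((hus.const_mul hs0 _).lintegral_exp_lt_top hs).ne
  have key : ∀ᵐ x ∂Q₀, (w x - v x) / β ≤ 0 := by
    refine ae_nonpos_of_lintegral_exp_bounded (e := fun x => v x / β) (by fun_prop)
      (by fun_prop) hC fun n => ?_
    -- The extrapolation `W ^ p V ^ (1 - p)` with `p = n + 1`, written as an exponential.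
    have e : ∀ x, ENNReal.ofReal (Real.exp (w x / β)) ^ (n + 1 : ℝ)
        * ENNReal.ofReal (Real.exp (v x / β)) ^ (1 - (n + 1 : ℝ))
        = ENNReal.ofReal (Real.exp ((n + 1) * ((w x - v x) / β) + v x / β)) := by
      intro x
      rw [ENNReal.ofReal_rpow_of_pos (Real.exp_pos _), ENNReal.ofReal_rpow_of_pos (Real.exp_pos _),
        ← ENNReal.ofReal_mul (by positivity), ← Real.exp_mul, ← Real.exp_mul, ← Real.exp_add]
      congr 2
      ring
    have h := lintegral_extrapolation_le (Q := Q) hQ hβ0 hβ1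
      (k := fun p => ENNReal.ofReal (Real.exp (α * u p))) (by fun_prop)
      (V := fun x => ENNReal.ofReal (Real.exp (v x / β)))
      (W := fun x => ENNReal.ofReal (Real.exp (w x / β))) (by fun_prop) (by fun_prop)
      (fun x => by simp [Real.exp_pos]) (fun x => ENNReal.ofReal_ne_top)
      (weightedOp_exp_of_continuationFun_eq hQ hβ0 α hs hu hus hv hvs hvfix)
      (weightedOp_exp_of_continuationFun_eq hQ hβ0 α hs hu hus hw hws hwfix)
      (p := n + 1) (by linarith [n.cast_nonneg (α := ℝ)])
    simp only [e] at h
    -- Finiteness of `E[B]`: the exponent is `(n + 1) w / β - n v / β`, and both terms have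
    -- exponential moments.
    refine h (((hws.const_mul hs0 ((n + 1) / β)).add hs0 (by fun_prop)
      (hvs.const_mul hs0 (n / β))).mono_ae hs0 (ae_of_all _ fun x => ?_)
      |>.lintegral_exp_lt_top hs).ne
    rw [abs_of_nonneg (by positivity : 0 ≤ |(n + 1) / β * w x| + |n / β * v x|)]
    refine le_trans (le_of_eq ?_) (abs_sub _ _)
    congr 1
    ring
  filter_upwards [key] with x hx
  by_contra hc
  exact absurd hx (not_le.2 (div_pos (sub_pos.2 (not_le.1 hc)) hβ0))

theorem exists_continuationFun_fixedPoint (hQ : Kernel.Invariant Q Q₀) (hβ0 : 0 < β)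
    (hβ1 : β < 1) (α : ℝ) {r : ℝ} (hr : 1 ≤ r) {u : X × X → ℝ} (hu : Measurable u)
    (hur : HasExpMoments (Q₀ ⊗ₘ Q) r u) :
    ∃ v : X → ℝ, Measurable v ∧ HasExpMoments Q₀ r v ∧ continuationFun Q β α u v =ᵐ[Q₀] v := by
  have hr0 : 0 ≤ r := by linarith
  obtain ⟨V, hVm, hpos, hfix, hVr⟩ := exists_weightedOp_fixedPoint hQ hβ0 hβ1
    (g := fun p => α * u p) (by fun_prop) hr (hur.const_mul hr0 α)
  have hvm : Measurable fun x => β * Real.log (V x).toReal :=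
    (Real.measurable_log.comp hVm.ennreal_toReal).const_mul β
  refine ⟨_, hvm, hVr.const_mul hr0 β, ?_⟩
  have hV : V =ᵐ[Q₀] fun y => ENNReal.ofReal (Real.exp (β * Real.log (V y).toReal / β)) := by
    filter_upwards [hpos] with y hy
    rw [mul_div_cancel_left₀ _ hβ0.ne', Real.exp_log (ENNReal.toReal_pos hy.1 hy.2),
      ENNReal.ofReal_toReal hy.2]
  filter_upwards [weightedOp_congr_ae (k := fun p => ENNReal.ofReal (Real.exp (α * u p))) hQ
    hβ0.le hV] with x hx
  rw [weightedOp_ofReal_exp hβ0.ne', hfix] at hx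
  rw [continuationFun_eq β α hu hvm, ← hx]

theorem continuationOp_eq_iff (α : ℝ) (u : X × X →ₘ[Q₀ ⊗ₘ Q] ℝ) (f : X →ₘ[Q₀] ℝ) :
    continuationOp Q Q₀ β α u f = f ↔ continuationFun Q β α u f =ᵐ[Q₀] f := by
  conv_lhs => rhs; rw [← AEEqFun.mk_coeFn f]
  exact AEEqFun.mk_eq_mk

end

end RobustControl

/-! ### Passage from representatives to classes. -/

theorem theorem3p1 {X : Type*} [MeasurableSpace X]
    (Q : Kernel X X) [IsMarkovKernel Q]
    (Q₀ : Measure X) [IsProbabilityMeasure Q₀] (hQ : Kernel.Invariant Q Q₀)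
    (β θ : ℝ) (hβ0 : 0 < β) (hβ1 : β < 1) (hθ : 0 < θ)
    (r : ℝ) (hr : 1 < r)
    (u : X × X →ₘ[Q₀ ⊗ₘ Q] ℝ) (hu : u ∈ RobustControl.orliczHeart (Q₀ ⊗ₘ Q) r) :
    -- the operator is well defined on each of the spaces considered
    (∀ s : ℝ, 1 ≤ s → s ≤ r → ∀ f ∈ RobustControl.orliczHeart Q₀ s,
      (∀ᵐ x ∂Q₀, Integrable
        (fun y => Real.exp (f y + RobustControl.compositeParam β θ * u (x, y))) (Q x)) ∧
      RobustControl.continuationOp Q Q₀ β (RobustControl.compositeParam β θ) u f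
        ∈ RobustControl.orliczHeart Q₀ s) ∧
    -- existence, and uniqueness in every larger space
    ∃ v ∈ RobustControl.orliczHeart Q₀ r,
      RobustControl.continuationOp Q Q₀ β (RobustControl.compositeParam β θ) u v = v ∧
      ∀ s : ℝ, 1 < s → s ≤ r →
        v ∈ RobustControl.orliczHeart Q₀ s ∧
        ∀ w ∈ RobustControl.orliczHeart Q₀ s,
          RobustControl.continuationOp Q Q₀ β (RobustControl.compositeParam β θ) u w = w →
            w = v := by
  have hu' := (RobustControl.mem_orliczHeart_iff_hasExpMoments hr.le u).1 hu
  have hmk : ∀ {s : ℝ} {f : X → ℝ} (hf : Measurable f), RobustControl.HasExpMoments Q₀ s f →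
      0 ≤ s → RobustControl.HasExpMoments Q₀ s (AEEqFun.mk f hf.aestronglyMeasurable : X →ₘ[Q₀] ℝ) :=
    fun {s f} hf hfs hs => hfs.mono_ae hs <| by
      filter_upwards [AEEqFun.coeFn_mk f (hf.aestronglyMeasurable (μ := Q₀))] with x hx
      rw [hx]
  have hus : ∀ {s : ℝ}, 1 ≤ s → s ≤ r → RobustControl.HasExpMoments (Q₀ ⊗ₘ Q) s u :=
    fun h1 h2 => hu'.mono_exponent (by linarith) h2
  refine ⟨fun s hs1 hsr f hf => ?_, ?_⟩
  · have hf' := (RobustControl.mem_orliczHeart_iff_hasExpMoments hs1 f).1 hf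
    obtain ⟨hfin, hmom⟩ := RobustControl.hasExpMoments_continuationFun (β := β) hQ
      (RobustControl.compositeParam β θ) hs1 u.measurable (hus hs1 hsr) f.measurable hf'
    refine ⟨?_, (RobustControl.mem_orliczHeart_iff_hasExpMoments hs1 _).2
      (hmk (RobustControl.measurable_continuationFun Q β _ u.measurable f.measurable) hmom
        (by linarith))⟩
    filter_upwards [hfin] with x hx
    have hum := u.measurable
    have hfm := f.measurable
    refine ⟨(by fun_prop : Measurable fun y => Real.exp
      (f y + RobustControl.compositeParam β θ * u (x, y))).aestronglyMeasurable, ?_⟩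
    rw [hasFiniteIntegral_iff_ofReal (ae_of_all _ fun y => (Real.exp_pos _).le)]
    exact hx
  · obtain ⟨v, hvm, hvr, hvfix⟩ := RobustControl.exists_continuationFun_fixedPoint hQ hβ0 hβ1
      (RobustControl.compositeParam β θ) hr.le u.measurable hu'
    set v' : X →ₘ[Q₀] ℝ := AEEqFun.mk v hvm.aestronglyMeasurable with hv'
    have hvv : v' =ᵐ[Q₀] v := AEEqFun.coeFn_mk v _
    have hv'r : RobustControl.HasExpMoments Q₀ r v' := hmk hvm hvr (by linarith)
    -- Stationarity allows `v` to be replaced by the chosen representative of its class inside `T`.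
    have hv'fix : RobustControl.continuationFun Q β (RobustControl.compositeParam β θ) u v'
        =ᵐ[Q₀] v' :=
      ((RobustControl.continuationFun_congr Q Q₀ hQ β _ (ae_eq_refl _) hvv).trans hvfix).trans
        hvv.symm
    refine ⟨v', (RobustControl.mem_orliczHeart_iff_hasExpMoments hr.le _).2 hv'r,
      (RobustControl.continuationOp_eq_iff _ u v').2 hv'fix, fun s hs1 hsr => ?_⟩
    have hv's := hv'r.mono_exponent (by linarith) hsr
    refine ⟨(RobustControl.mem_orliczHeart_iff_hasExpMoments hs1.le _).2 hv's,
      fun w hw hwfix => ?_⟩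
    have hw' := (RobustControl.mem_orliczHeart_iff_hasExpMoments hs1.le w).1 hw
    have hwfix' := (RobustControl.continuationOp_eq_iff _ u w).1 hwfix
    refine AEEqFun.ext (Filter.EventuallyLE.antisymm ?_ ?_)
    · exact RobustControl.le_ae_of_continuationFun_eq hQ hβ0 hβ1 _ hs1.le u.measurable
        (hus hs1.le hsr) v'.measurable w.measurable hv's hw' hv'fix hwfix'
    · exact RobustControl.le_ae_of_continuationFun_eq hQ hβ0 hβ1 _ hs1.le u.measurable
        (hus hs1.le hsr) w.measurable v'.measurable hw' hv's hwfix' hv'fix
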